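/- There exist functions $f,g:\mathbb N\to\mathbb N$ with the following property. For a group $H$, let $Z_0(H)=1$, let $Z_{\alpha+1}(H)/Z_\alpha(H)$ be the center of $H/Z_\alpha(H)$ for every ordinal $\alpha$, and let $Z_\lambda(H)=\bigcup_{\alpha<\lambda}Z_\alpha(H)$ for limit ordinals $\lambda$; the hypercenter $Z_\infty(H)$ is the last term (the union) of this ascending series, and $H$ is called hypercentral if $H=Z_\infty(H)$. Let $G$ be a group with a finite series $$G=G_0\ge F_1\ge G_1\ge\dots\ge F_n\ge G_n=1$$ of normal subgroups of $G$ such that, for each $i=1,\dots,n$, the factor $F_i/G_i$ is finite of order $t_i>1$ and $G_{i-1}/F_i\le Z_\infty(G/F_i)$. Put $t=t_1\cdots t_n$. Then $G$ has a finite normal subgroup $L$ with $|L|\le f(t)$ such that $G/L$ is hypercentral. Moreover, $Z_\infty(G)$ has finite index in $G$, and $|G:Z_\infty(G)|\le g(t)$. -/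

import Mathlib

universe u

/-- The transfinite upper central series, bundled with the normality of its terms:
`Z_0 = 1`, `Z_{α+1}` is the preimage in `G` of the centre of `G / Z_α`, and at a limit ordinal the
supremum (by `mem_transfiniteCenter_limit`, the union) of the earlier terms is taken. -/
noncomputable def transfiniteCenterAux (G : Type u) [Group G] (α : Ordinal.{u}) :
    {N : Subgroup G // N.Normal} :=
  Ordinal.limitRecOn α
    ⟨⊥, inferInstance⟩
    (fun _ N =>
      haveI := N.2
      ⟨(Subgroup.center (G ⧸ N.1)).comap (QuotientGroup.mk' N.1), inferInstance⟩)
    (fun l _ Z =>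
      ⟨⨆ β : Set.Iio l, (Z β.1 β.2).1, haveI := fun β : Set.Iio l => (Z β.1 β.2).2; inferInstance⟩)

/-- The `α`-th centre `Z_α(G)` of `G`, for an ordinal `α`. -/
noncomputable def transfiniteCenter (G : Type u) [Group G] (α : Ordinal.{u}) : Subgroup G :=
  (transfiniteCenterAux G α).1

instance transfiniteCenter_normal (G : Type u) [Group G] (α : Ordinal.{u}) :
    (transfiniteCenter G α).Normal :=
  (transfiniteCenterAux G α).2

/-- The hypercenter `Z_∞(G)`: the last term of the transfinite upper central series, that is, the
union of all its terms (see `exists_transfiniteCenter_eq_hypercenter`). -/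
noncomputable def hypercenter (G : Type u) [Group G] : Subgroup G :=
  ⨆ α : Ordinal.{u}, transfiniteCenter G α

/-- A group is hypercentral if it coincides with its hypercenter. -/
def IsHypercentral (G : Type u) [Group G] : Prop :=
  hypercenter G = ⊤

theorem transfiniteCenter_zero (G : Type u) [Group G] : transfiniteCenter G 0 = ⊥ := by
  simp [transfiniteCenter, transfiniteCenterAux]

theorem transfiniteCenter_succ (G : Type u) [Group G] (α : Ordinal.{u}) :
    transfiniteCenter G (α + 1) =
      (Subgroup.center (G ⧸ transfiniteCenter G α)).comap
        (QuotientGroup.mk' (transfiniteCenter G α)) := by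
  have h : transfiniteCenterAux G (α + 1) = _ := Ordinal.limitRecOn_add_one α _ _ _
  exact congrArg Subtype.val h

theorem transfiniteCenter_limit (G : Type u) [Group G] {l : Ordinal.{u}}
    (hl : Order.IsSuccLimit l) :
    transfiniteCenter G l = ⨆ β : Set.Iio l, transfiniteCenter G β.1 := by
  have h : transfiniteCenterAux G l = _ := Ordinal.limitRecOn_limit l _ _ _ hl
  exact congrArg Subtype.val h

theorem transfiniteCenter_mono (G : Type u) [Group G] : Monotone (transfiniteCenter G) := by
  intro α β
  induction β using Ordinal.limitRecOn with
  | zero =>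
    intro h
    rw [show α = 0 by simpa using h]
  | add_one β ih =>
    intro h
    rcases h.eq_or_lt with rfl | h
    · exact le_rfl
    refine (ih (Order.lt_add_one_iff.mp h)).trans ?_
    rw [transfiniteCenter_succ]
    intro x hx
    rw [Subgroup.mem_comap, QuotientGroup.mk'_apply, (QuotientGroup.eq_one_iff x).mpr hx]
    exact one_mem _
  | limit l hl ih =>
    intro h
    rcases h.eq_or_lt with rfl | h
    · exact le_rfl
    rw [transfiniteCenter_limit G hl]
    exact le_iSup (fun β : Set.Iio l => transfiniteCenter G β.1) ⟨α, h⟩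

theorem mem_transfiniteCenter_limit (G : Type u) [Group G] {l : Ordinal.{u}}
    (hl : Order.IsSuccLimit l) (x : G) :
    x ∈ transfiniteCenter G l ↔ ∃ β < l, x ∈ transfiniteCenter G β := by
  have : Nonempty (Set.Iio l) := ⟨⟨0, hl.bot_lt⟩⟩
  rw [transfiniteCenter_limit G hl, Subgroup.mem_iSup_of_directed]
  · simp
  · exact Monotone.directed_le fun a b h => transfiniteCenter_mono G h

theorem exists_transfiniteCenter_eq_hypercenter (G : Type u) [Group G] :
    ∃ α : Ordinal.{u}, transfiniteCenter G α = hypercenter G := by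
  have hmem (x : G) : x ∈ hypercenter G ↔ ∃ α, x ∈ transfiniteCenter G α :=
    Subgroup.mem_iSup_of_directed (transfiniteCenter_mono G).directed_le
  choose a ha using fun x : hypercenter G => (hmem x).mp x.2
  refine ⟨⨆ x, a x, le_antisymm (le_iSup (transfiniteCenter G) _) fun x hx => ?_⟩
  exact transfiniteCenter_mono G (Ordinal.le_iSup a ⟨x, hx⟩) (ha ⟨x, hx⟩)

/-! Two properties of a group imply each other, with explicit bounds: having a finite normal
subgroup with hypercentral quotient, and having a hypercenter of finite index. The proof moves down
the series by alternating between them.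

Suppose `B / G_{i-1}` is finite and `G / B` is hypercentral. By `index_hypercenter_quotient_le` the
hypercenter of `G / G_{i-1}` has bounded index. Since `G_{i-1} / F_i` is hypercentrally embedded, so
does the hypercenter of `G / F_i`. Then `exists_finite_hyperOver_top` gives a bounded `L / F_i` with
`G / L` hypercentral, and `|L : G_i| = |L : F_i| t_i`. At `G_n = 1` this is the required subgroup.
Every `t_i` is at least 2, so `n ≤ t` and the bound can be made independent of `n`.

Both implications rest on Fitting-type facts about a hypercentral group acting on an abelian
section: absence of fixed points passes to quotients by finite submodules (`closedIn_of_finite`),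
and central parts split off (`exists_complement`). For the first implication, factoring out the
hypercenter leaves a centreless group, whose finite subgroup `L` contains its own centralizer. For
the second, in a finitely generated subgroup the hypercenter is reached after finitely many steps,
and Schur's theorem and a complement give a lower central term of bounded order. A finitely
generated subgroup with largest nilpotent residual then handles all of `G`. -/

namespace HypercentralSeries

open Subgroup QuotientGroup
open scoped commutatorElement

/-! ### Induction along the upper central series. -/

section Hypercenter

variable {G : Type u} [Group G]

theorem mem_transfiniteCenter_succ (α : Ordinal.{u}) (x : G) :
    x ∈ transfiniteCenter G (α + 1) ↔ ∀ g : G, ⁅x, g⁆ ∈ transfiniteCenter G α := by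
  rw [transfiniteCenter_succ, ← Subgroup.upperCentralSeriesStep_eq_comap_center,
    Subgroup.mem_upperCentralSeriesStep]

theorem mem_hypercenter_iff (x : G) :
    x ∈ hypercenter G ↔ ∃ α : Ordinal.{u}, x ∈ transfiniteCenter G α :=
  Subgroup.mem_iSup_of_directed (transfiniteCenter_mono G).directed_le

instance hypercenter_normal : (hypercenter G).Normal := by
  obtain ⟨α, hα⟩ := exists_transfiniteCenter_eq_hypercenter G
  rw [← hα]
  infer_instance

theorem mem_hypercenter_of_commutator_mem {x : G} (hx : ∀ g : G, ⁅x, g⁆ ∈ hypercenter G) :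
    x ∈ hypercenter G := by
  obtain ⟨α, hα⟩ := exists_transfiniteCenter_eq_hypercenter G
  rw [← hα] at hx
  exact (mem_hypercenter_iff x).2 ⟨α + 1, (mem_transfiniteCenter_succ α x).2 hx⟩

/-- Induction along the upper central series, relative to a subset `V` that is stable under
commutators with elements of `H`. -/
theorem mem_of_mem_hypercenter {V H K : Set G} (hV : ∀ x ∈ V, ∀ g ∈ H, ⁅x, g⁆ ∈ V)
    (hone : (1 : G) ∈ K) (hK : ∀ x ∈ V, (∀ g ∈ H, ⁅x, g⁆ ∈ K) → x ∈ K) {x : G} (hxV : x ∈ V)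
    (hx : x ∈ hypercenter G) : x ∈ K := by
  obtain ⟨α, hα⟩ := (mem_hypercenter_iff x).1 hx
  clear hx
  induction α using Ordinal.limitRecOn generalizing x with
  | zero =>
    rw [transfiniteCenter_zero, mem_bot] at hα
    exact hα ▸ hone
  | add_one α ih =>
    rw [mem_transfiniteCenter_succ] at hα
    exact hK x hxV fun g hg => ih (hV x hxV g hg) (hα g)
  | limit l hl ih =>
    rw [mem_transfiniteCenter_limit G hl] at hα
    obtain ⟨β, hβ, hx⟩ := hα
    exact ih β hβ hxV hx

end Hypercenter

/-! ### Hypercentral embedding without ordinals. -/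

section HyperOver

variable {G : Type u} [Group G]

/-- `K` contains every element of `V` that is central modulo `K`. -/
def ClosedIn (K V : Subgroup G) : Prop :=
  ∀ x ∈ V, (∀ g : G, ⁅x, g⁆ ∈ K) → x ∈ K

/-- The factor `B / A` is contained in the hypercenter of `G / A`, in a form free of ordinals. -/
def HyperOver (A B : Subgroup G) : Prop :=
  ∀ K : Subgroup G, K.Normal → A ≤ K → ClosedIn K B → B ≤ K

theorem ClosedIn.mono {K V V' : Subgroup G} (h : ClosedIn K V) (hV : V' ≤ V) : ClosedIn K V' :=
  fun x hx => h x (hV hx)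

theorem HyperOver.mono {A A' B : Subgroup G} (h : HyperOver A B) (hA : A ≤ A') : HyperOver A' B :=
  fun K hK hAK => h K hK (hA.trans hAK)

theorem HyperOver.trans {A B D : Subgroup G} (h₁ : HyperOver A B) (h₂ : HyperOver B D)
    (hBD : B ≤ D) : HyperOver A D :=
  fun K hK hAK hc => h₂ K hK (h₁ K hK hAK (hc.mono hBD)) hc

theorem commutator_mem_left {N : Subgroup G} (hN : N.Normal) {x : G} (hx : x ∈ N) (g : G) :
    ⁅x, g⁆ ∈ N := by
  rw [commutatorElement_def, mul_assoc, mul_assoc, ← mul_assoc g]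
  exact N.mul_mem hx (hN.conj_mem _ (N.inv_mem hx) g)

theorem mk_commutator (A : Subgroup G) [A.Normal] (x g : G) :
    ((⁅x, g⁆ : G) : G ⧸ A) = ⁅(x : G ⧸ A), (g : G ⧸ A)⁆ :=
  map_commutatorElement (mk' A) x g

theorem mem_comap_hypercenter_of_commutator_mem {A : Subgroup G} [A.Normal] {x : G}
    (hx : ∀ g : G, ⁅x, g⁆ ∈ (hypercenter (G ⧸ A)).comap (mk' A)) :
    x ∈ (hypercenter (G ⧸ A)).comap (mk' A) := by
  rw [mem_comap]
  refine mem_hypercenter_of_commutator_mem fun g => ?_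
  induction g using QuotientGroup.induction_on with
  | H g =>
    have := hx g
    rwa [mem_comap, mk'_apply, mk_commutator] at this

theorem hyperOver_of_le_comap {A B : Subgroup G} [A.Normal] (hB : B.Normal)
    (h : B ≤ (hypercenter (G ⧸ A)).comap (mk' A)) : HyperOver A B := by
  intro K hK hAK hc x hx
  have key : (mk' A x : G ⧸ A) ∈ Set.image (mk' A) (K : Set G) := by
    refine mem_of_mem_hypercenter (V := Set.image (mk' A) (B : Set G)) (H := Set.univ)
      ?_ ?_ ?_ ?_ (h hx)
    · rintro _ ⟨y, hy, rfl⟩ g -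
      induction g using QuotientGroup.induction_on with
      | H g => exact ⟨⁅y, g⁆, commutator_mem_left hB hy g, mk_commutator A y g⟩
    · exact ⟨1, one_mem K, map_one _⟩
    · rintro _ ⟨y, hy, rfl⟩ hg
      refine ⟨y, hc y hy fun g => ?_, rfl⟩
      obtain ⟨k, hk, hkg⟩ := hg g trivial
      rw [mk'_apply, mk'_apply, ← mk_commutator, QuotientGroup.eq] at hkg
      simpa using K.mul_mem hk (hAK hkg)
    · exact ⟨x, hx, rfl⟩
  obtain ⟨k, hk, hkx⟩ := key
  rw [mk'_apply, mk'_apply, QuotientGroup.eq] at hkx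
  simpa using K.mul_mem hk (hAK hkx)

/-- The preimage of the hypercenter is itself an admissible `K` in `HyperOver`; conversely,
transfinite induction puts `B` into every admissible `K`. -/
theorem hyperOver_iff {A B : Subgroup G} [A.Normal] (hB : B.Normal) :
    HyperOver A B ↔ B ≤ (hypercenter (G ⧸ A)).comap (mk' A) := by
  refine ⟨fun h => h _ inferInstance ?_ fun x _ => mem_comap_hypercenter_of_commutator_mem,
    hyperOver_of_le_comap hB⟩
  intro x hx
  rw [mem_comap, mk'_apply, (QuotientGroup.eq_one_iff x).2 hx]
  exact one_mem _

theorem HyperOver.of_le {A B B' : Subgroup G} [A.Normal] (hB : B.Normal) (hB' : B'.Normal)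
    (h : HyperOver A B) (hle : B' ≤ B) : HyperOver A B' :=
  (hyperOver_iff hB').2 (hle.trans ((hyperOver_iff hB).1 h))

theorem isHypercentral_quotient_iff {A : Subgroup G} [A.Normal] :
    IsHypercentral (G ⧸ A) ↔ HyperOver A ⊤ := by
  rw [hyperOver_iff inferInstance, top_le_iff, IsHypercentral]
  refine ⟨fun h => by rw [h, comap_top], fun h => ?_⟩
  rw [← map_comap_eq_self_of_surjective (mk'_surjective A) (hypercenter (G ⧸ A)), h,
    map_top_of_surjective _ (mk'_surjective A)]

theorem hyperOver_bot_hypercenter : HyperOver (⊥ : Subgroup G) (hypercenter G) :=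
  fun K _ _ hc _ hx => mem_of_mem_hypercenter (V := (hypercenter G : Set G)) (H := Set.univ)
    (fun _ hx g _ => commutator_mem_left inferInstance hx g) (one_mem K)
    (fun x hx h => hc x hx fun g => h g trivial) hx hx

theorem le_hypercenter_iff {B : Subgroup G} (hB : B.Normal) :
    B ≤ hypercenter G ↔ HyperOver ⊥ B := by
  refine ⟨fun h K _ _ hc x hx => ?_, fun h => h _ inferInstance bot_le fun x _ =>
    mem_hypercenter_of_commutator_mem⟩
  exact mem_of_mem_hypercenter (V := (B : Set G)) (H := Set.univ)
    (fun _ hx g _ => commutator_mem_left hB hx g) (one_mem K)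
    (fun x hx h => hc x hx fun g => h g trivial) hx (h hx)

end HyperOver

/-! ### Equivariant homomorphisms from commutation with one element. -/

section Derivation

variable {G : Type u} [Group G]

/-- `δ` restricts to a homomorphism `N → G / B` commuting with conjugation by `G`. -/
structure IsEquivariantHom (B N : Subgroup G) [B.Normal] (δ : G → G ⧸ B) : Prop where
  map_mul : ∀ v ∈ N, ∀ w ∈ N, δ (v * w) = δ v * δ w
  map_conj : ∀ g, ∀ v ∈ N, δ (g * v * g⁻¹) = (g : G ⧸ B) * δ v * (g : G ⧸ B)⁻¹

/-- If `G / C` is hypercentral and acts non-trivially by conjugation on the abelian factor `N / B`,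
then some `z` yields a non-trivial equivariant homomorphism `v ↦ ⁅v, z⁆` from `N` to `G / B`. -/
theorem exists_equivariant_hom {C B N : Subgroup G} [hBn : B.Normal] (hNn : N.Normal)
    (hNN : ⁅N, N⁆ ≤ B) (hNC : ⁅N, C⁆ ≤ B) (hC : HyperOver C ⊤) (hN : ¬ ∀ v ∈ N, ∀ g, ⁅v, g⁆ ∈ B) :
    ∃ δ : G → G ⧸ B, (∃ z : G, ∀ v, δ v = ((⁅v, z⁆ : G) : G ⧸ B)) ∧
      IsEquivariantHom B N δ ∧ ∃ v ∈ N, δ v ≠ 1 := by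
  -- `K` is the kernel of the action of `G` on `N / B`. As `G / K` is a non-trivial quotient of a
  -- hypercentral group, some `z` outside `K` is central modulo `K`.
  let K : Subgroup G :=
    ⨅ v : N, (centralizer {((v : G) : G ⧸ B)}).comap (mk' B)
  have hK : ∀ g, g ∈ K ↔ ∀ v ∈ N, ⁅v, g⁆ ∈ B := by
    intro g
    simp only [K, mem_iInf, mem_comap, mem_centralizer_singleton_iff, Subtype.forall, mk'_apply]
    refine forall₂_congr fun v hv => ?_
    rw [← QuotientGroup.eq_one_iff, mk_commutator, commutatorElement_eq_one_iff_mul_comm, eq_comm]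
  have hKn : K.Normal := by
    refine ⟨fun k hk g => ?_⟩
    rw [hK] at hk ⊢
    intro v hv
    have h := hBn.conj_mem _ (hk _ (hNn.conj_mem v hv g⁻¹)) g
    rw [conjugate_commutatorElement] at h
    convert! h using 2
    group
  have hCK : C ≤ K := fun c hc => (hK c).2 fun v hv => hNC (commutator_mem_commutator hv hc)
  have hex : ∃ z, z ∉ K ∧ ∀ g, ⁅z, g⁆ ∈ K := by
    by_contra! h
    have := hC K hKn hCK fun x _ hx => by
      by_contra hxK
      obtain ⟨g, hg⟩ := h x hxK
      exact hg (hx g)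
    exact hN fun v hv g => (hK g).1 (this (mem_top g)) v hv
  obtain ⟨z, hzK, hz⟩ := hex
  refine ⟨fun v => ((⁅v, z⁆ : G) : G ⧸ B), ⟨z, fun v => rfl⟩, ⟨?_, ?_⟩, ?_⟩
  · intro v hv w hw
    have h1 : Commute (v : G ⧸ B) ((⁅w, z⁆ : G) : G ⧸ B) := by
      rw [← commutatorElement_eq_one_iff_commute, ← mk_commutator, QuotientGroup.eq_one_iff]
      exact hNN (commutator_mem_commutator hv (commutator_mem_left hNn hw z))
    have h2 : Commute ((⁅w, z⁆ : G) : G ⧸ B) ((⁅v, z⁆ : G) : G ⧸ B) := by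
      rw [← commutatorElement_eq_one_iff_commute, ← mk_commutator, QuotientGroup.eq_one_iff]
      exact hNN (commutator_mem_commutator (commutator_mem_left hNn hw z)
        (commutator_mem_left hNn hv z))
    rw [commutatorElement_mul_left_eq_conj_mul, QuotientGroup.mk_mul, QuotientGroup.mk_mul,
      QuotientGroup.mk_mul, QuotientGroup.mk_inv, h1.eq, mul_inv_cancel_right, h2.eq]
  · intro g v hv
    have hw := hNn.conj_mem v hv g
    -- Conjugation changes `z` only by an element of `K`, which acts trivially on `N / B`; hence
    -- equivariance.
    have hzg : ∃ k ∈ K, g * z * g⁻¹ = k * z :=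
      ⟨⁅g, z⁆, by simpa using K.inv_mem (hz g), by group⟩
    obtain ⟨k, hk, hkz⟩ := hzg
    have h1 : ((g * ⁅v, z⁆ * g⁻¹ : G) : G ⧸ B) = ((⁅g * v * g⁻¹, z⁆ : G) : G ⧸ B) := by
      rw [conjugate_commutatorElement, hkz, commutatorElement_mul_right_eq_mul_conj]
      have h2 := (hK k).1 hk _ hw
      have h3 := (hK k).1 hk _ (commutator_mem_left hNn hw z)
      rw [← QuotientGroup.eq_one_iff, mk_commutator, commutatorElement_eq_one_iff_mul_comm] at h3
      rw [QuotientGroup.mk_mul, QuotientGroup.mk_mul, QuotientGroup.mk_mul,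
        (QuotientGroup.eq_one_iff _).2 h2, one_mul, ← h3, QuotientGroup.mk_inv,
        mul_inv_cancel_right]
    rw [← h1]
    rfl
  · by_contra! h
    exact hzK ((hK z).2 fun v hv => (QuotientGroup.eq_one_iff _).1 (h v hv))

variable {B N : Subgroup G} [B.Normal] {δ : G → G ⧸ B}

theorem IsEquivariantHom.map_one (h : IsEquivariantHom B N δ) : δ 1 = 1 := by
  simpa using h.map_mul 1 (one_mem N) 1 (one_mem N)

theorem IsEquivariantHom.map_inv (h : IsEquivariantHom B N δ) {v : G} (hv : v ∈ N) :
    δ v⁻¹ = (δ v)⁻¹ := by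
  rw [eq_inv_iff_mul_eq_one, ← h.map_mul _ (N.inv_mem hv) _ hv, inv_mul_cancel, h.map_one]

theorem IsEquivariantHom.map_commutator (h : IsEquivariantHom B N δ) (hNn : N.Normal) {v : G}
    (hv : v ∈ N) (g : G) : δ ⁅v, g⁆ = ⁅δ v, (g : G ⧸ B)⁆ := by
  rw [commutatorElement_def, mul_assoc, mul_assoc, ← mul_assoc g,
    h.map_mul v hv _ (hNn.conj_mem _ (N.inv_mem hv) g), h.map_conj g _ (N.inv_mem hv),
    h.map_inv hv, commutatorElement_def]
  group

theorem IsEquivariantHom.exists_kernel (h : IsEquivariantHom B N δ) (hNn : N.Normal) :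
    ∃ K : Subgroup G, K.Normal ∧ ∀ x, x ∈ K ↔ x ∈ N ∧ δ x = 1 := by
  refine ⟨{ carrier := {x | x ∈ N ∧ δ x = 1}
            one_mem' := ⟨one_mem N, h.map_one⟩
            mul_mem' := ?_, inv_mem' := ?_ }, ⟨?_⟩, fun x => Iff.rfl⟩
  · rintro a b ⟨ha, ha'⟩ ⟨hb, hb'⟩
    exact ⟨N.mul_mem ha hb, by rw [h.map_mul a ha b hb, ha', hb', one_mul]⟩
  · rintro a ⟨ha, ha'⟩
    exact ⟨N.inv_mem ha, by rw [h.map_inv ha, ha', inv_one]⟩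
  · rintro a ⟨ha, ha'⟩ g
    exact ⟨hNn.conj_mem a ha g, by rw [h.map_conj g a ha, ha', mul_one, mul_inv_cancel]⟩

theorem IsEquivariantHom.exists_image (h : IsEquivariantHom B N δ) {T : Subgroup G}
    (hT : T.Normal) (hTN : T ≤ N) :
    ∃ I : Subgroup G, I.Normal ∧ ∀ x, x ∈ I ↔ ∃ v ∈ T, (x : G ⧸ B) = δ v := by
  refine ⟨{ carrier := {x | ∃ v ∈ T, (x : G ⧸ B) = δ v}
            one_mem' := ⟨1, one_mem T, h.map_one.symm⟩
            mul_mem' := ?_, inv_mem' := ?_ }, ⟨?_⟩, fun x => Iff.rfl⟩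
  · rintro a b ⟨v, hv, ha⟩ ⟨w, hw, hb⟩
    exact ⟨v * w, T.mul_mem hv hw, by
      rw [h.map_mul v (hTN hv) w (hTN hw), QuotientGroup.mk_mul, ha, hb]⟩
  · rintro a ⟨v, hv, ha⟩
    exact ⟨v⁻¹, T.inv_mem hv, by rw [h.map_inv (hTN hv), QuotientGroup.mk_inv, ha]⟩
  · rintro a ⟨v, hv, ha⟩ g
    exact ⟨g * v * g⁻¹, hT.conj_mem v hv g, by
      rw [h.map_conj g v (hTN hv), QuotientGroup.mk_mul, QuotientGroup.mk_mul,
        QuotientGroup.mk_inv, ha]⟩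

end Derivation

/-! ### Fitting-type results: fixed points and complements. -/

section Fitting

variable {G : Type u} [Group G]

theorem relIndex_lt_of_lt {A K W : Subgroup G} (hAK : A ≤ K) (hKW : K < W)
    (hfin : A.relIndex W ≠ 0) : A.relIndex K < A.relIndex W ∧ A.relIndex K ≠ 0 := by
  have h := relIndex_mul_relIndex A K W hAK hKW.le
  have h0 : A.relIndex K ≠ 0 := fun h' => hfin (by rw [← h, h', zero_mul])
  have h1 : K.relIndex W ≠ 0 := fun h' => hfin (by rw [← h, h', mul_zero])
  have h2 : K.relIndex W ≠ 1 := fun h' => hKW.not_ge (relIndex_eq_one.1 h')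
  refine ⟨?_, h0⟩
  rw [← h]
  exact lt_mul_of_one_lt_right (Nat.pos_of_ne_zero h0) (by omega)

/-- Let a hypercentral group act on an abelian factor `V / A` without non-trivial fixed points.
Then the action on `V / W` has no non-trivial fixed points either if `W / A` is finite. -/
theorem closedIn_of_finite {C A V : Subgroup G} [hAn : A.Normal] (hVn : V.Normal)
    (hVV : ⁅V, V⁆ ≤ A) (hVC : ⁅V, C⁆ ≤ A) (hC : HyperOver C ⊤) (hA : ClosedIn A V) :
    ∀ W : Subgroup G, W.Normal → A ≤ W → W ≤ V → A.relIndex W ≠ 0 → ClosedIn W V := by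
  intro W
  induction hn : A.relIndex W using Nat.strong_induction_on generalizing W with
  | _ n ih =>
  subst hn
  intro hWn hAW hWV hfin x hxV hx
  have ih' : ∀ K : Subgroup G, K.Normal → A ≤ K → K < W → ClosedIn K V := by
    intro K hKn hAK hKW
    obtain ⟨h1, h2⟩ := relIndex_lt_of_lt hAK hKW hfin
    exact ih _ h1 K rfl hKn hAK (hKW.le.trans hWV) h2
  by_contra hxW
  -- `N / W` is the group of fixed points of `V / W`, so `v ↦ ⁅v, z⁆` sends `N` into `W`.
  let N : Subgroup G := V ⊓ W.upperCentralSeriesStep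
  have hNn : N.Normal := by
    have : W.upperCentralSeriesStep.Normal := by
      rw [Subgroup.upperCentralSeriesStep_eq_comap_center]
      infer_instance
    infer_instance
  have hNmem : ∀ y, y ∈ N ↔ y ∈ V ∧ ∀ g, ⁅y, g⁆ ∈ W := fun y => Iff.rfl
  have hWN : W ≤ N := fun y hy => (hNmem y).2 ⟨hWV hy, commutator_mem_left hWn hy⟩
  have hNV : N ≤ V := inf_le_left
  have hxN : x ∈ N := (hNmem x).2 ⟨hxV, hx⟩
  obtain ⟨δ, ⟨z, hz⟩, hδ, v, hvN, hv⟩ := exists_equivariant_hom hNn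
    ((commutator_mono hNV hNV).trans hVV) ((commutator_mono hNV le_rfl).trans hVC) hC
    (fun h => hxW (hAW (hA x hxV (h x hxN))))
  obtain ⟨I, hIn, hI⟩ := hδ.exists_image hWn hWN
  obtain ⟨K, hKn, hK⟩ := hδ.exists_kernel hNn
  have hAI : A ≤ I := fun a ha => (hI a).2 ⟨1, one_mem W, by
    rw [hδ.map_one, (QuotientGroup.eq_one_iff a).2 ha]⟩
  have hIW : I ≤ W := by
    intro y hy
    obtain ⟨w, hw, hyw⟩ := (hI y).1 hy
    rw [hz, eq_comm, QuotientGroup.eq] at hyw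
    rw [← mul_inv_cancel_left ⁅w, z⁆ y]
    exact W.mul_mem (commutator_mem_left hWn hw z) (hAW hyw)
  -- `δ` has the same image on `N` as on `W`: if `I < W`, then `δ y` is fixed modulo `I`, and
  -- induction applies to `I`.
  have hNI : ∀ y ∈ N, ∃ w ∈ W, δ y = δ w := by
    intro y hy
    have hyW : ⁅y, z⁆ ∈ W := ((hNmem y).1 hy).2 z
    suffices h : ⁅y, z⁆ ∈ I by
      obtain ⟨w, hw, hyw⟩ := (hI _).1 h
      exact ⟨w, hw, by rw [← hyw, hz]⟩
    rcases hIW.eq_or_lt with h | h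
    · rwa [h]
    · refine ih' I hIn hAI h _ (hWV hyW) fun g => (hI _).2 ⟨⁅y, g⁆, ((hNmem y).1 hy).2 g, ?_⟩
      rw [hδ.map_commutator hNn hy, hz, mk_commutator]
  -- Since `δ` is non-trivial on `W`, induction also applies to `W ⊓ K`. Correcting `x` by an
  -- element of `W` moves it into the kernel `K`, where it is fixed modulo `W ⊓ K`.
  have hlt : W ⊓ K < W := by
    refine lt_of_le_of_ne inf_le_left fun h => hv ?_
    obtain ⟨w, hw, hvw⟩ := hNI v hvN
    rw [hvw]
    exact ((hK w).1 (inf_eq_left.1 h hw)).2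
  obtain ⟨w, hw, hxw⟩ := hNI x hxN
  have hyN : w⁻¹ * x ∈ N := N.mul_mem (N.inv_mem (hWN hw)) hxN
  have hyK : w⁻¹ * x ∈ K := (hK _).2 ⟨hyN, by
    rw [hδ.map_mul _ (N.inv_mem (hWN hw)) _ hxN, hδ.map_inv (hWN hw), hxw, inv_mul_cancel]⟩
  have hAWK : A ≤ W ⊓ K := le_inf hAW fun a ha => (hK a).2 ⟨hWN (hAW ha), by
    rw [hz, QuotientGroup.eq_one_iff]; exact commutator_mem_left hAn ha z⟩
  have := ih' (W ⊓ K) inferInstance hAWK hlt _ (hNV hyN) fun g =>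
    mem_inf.2 ⟨((hNmem _).1 hyN).2 g, commutator_mem_left hKn hyK g⟩
  exact hxW (by simpa using W.mul_mem hw (mem_inf.1 this).1)

/-- Let a hypercentral group act on an abelian factor `M / A₀`, trivially on `A / A₀`, and such
that no section of the finite factor `M / A` has non-trivial fixed points.
Then `A / A₀` has an invariant complement in `M / A₀`. -/
theorem exists_complement {C A₀ A M : Subgroup G} (hA₀n : A₀.Normal) (hAn : A.Normal)
    (hMn : M.Normal) (hA₀A : A₀ ≤ A) (hAM : A ≤ M) (hMM : ⁅M, M⁆ ≤ A₀) (hMC : ⁅M, C⁆ ≤ A₀)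
    (hC : HyperOver C ⊤) (hA : ∀ a ∈ A, ∀ g, ⁅a, g⁆ ∈ A₀)
    (hcl : ∀ W : Subgroup G, W.Normal → A ≤ W → W ≤ M → ClosedIn W M)
    (hfin : A.relIndex M ≠ 0) :
    ∃ B : Subgroup G, B.Normal ∧ A₀ ≤ B ∧ B ≤ M ∧ B ⊓ A = A₀ ∧ B ⊔ A = M := by
  let P : Set (Subgroup G) := {B | B.Normal ∧ A₀ ≤ B ∧ B ≤ M ∧ B ⊓ A ≤ A₀}
  -- Minimizing the index of `B ⊔ A` takes the place of choosing a maximal `B`.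
  obtain ⟨B, ⟨hBn, hA₀B, hBM, hBA⟩, hmin⟩ :=
    exists_minimalFor_of_wellFoundedLT (· ∈ P) (fun B : Subgroup G => (B ⊔ A).relIndex M)
      ⟨A₀, hA₀n, le_rfl, hA₀A.trans hAM, inf_le_left⟩
  refine ⟨B, hBn, hA₀B, hBM, le_antisymm hBA (le_inf hA₀B hA₀A), ?_⟩
  by_contra hne
  have hlt : B ⊔ A < M := lt_of_le_of_ne (sup_le hBM hAM) hne
  have hfin' : (B ⊔ A).relIndex M ≠ 0 :=
    fun h => hfin (relIndex_eq_zero_of_le_left le_sup_right h)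
  let Q : Set (Subgroup G) := {N | N.Normal ∧ B ⊔ A < N ∧ N ≤ M}
  obtain ⟨N, ⟨hNn, hlN, hNM⟩, hNmin⟩ :=
    exists_minimalFor_of_wellFoundedLT (· ∈ Q) (fun N : Subgroup G => (B ⊔ A).relIndex N)
      ⟨M, hMn, hlt, le_rfl⟩
  have hBN : B ≤ N := le_sup_left.trans hlN.le
  have hAN : A ≤ N := le_sup_right.trans hlN.le
  have hclBA : ClosedIn (B ⊔ A) M := hcl _ inferInstance le_sup_right hlt.le
  obtain ⟨δ, ⟨z, hz⟩, hδ, v, hvN, hv⟩ := exists_equivariant_hom (B := B) hNn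
    (((commutator_mono hNM hNM).trans hMM).trans hA₀B)
    (((commutator_mono hNM le_rfl).trans hMC).trans hA₀B) hC
    (fun h => hlN.not_ge fun x hx => hclBA x (hNM hx) fun g => le_sup_left (a := B) (h x hx g))
  obtain ⟨I, hIn, hI⟩ := hδ.exists_image hNn le_rfl
  obtain ⟨K, hKn, hK⟩ := hδ.exists_kernel hNn
  have hKN : K ≤ N := fun x hx => ((hK x).1 hx).1
  have hle : B ⊔ A ≤ K := by
    refine sup_le (fun b hb => (hK b).2 ⟨hBN hb, ?_⟩) fun a ha => (hK a).2 ⟨hAN ha, ?_⟩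
    · rw [hz, QuotientGroup.eq_one_iff]
      exact commutator_mem_left hBn hb z
    · rw [hz, QuotientGroup.eq_one_iff]
      exact hA₀B (hA a ha z)
  have hKlt : K < N := lt_of_le_of_ne hKN fun h => hv ((hK v).1 (h ▸ hvN)).2
  -- Minimality of `N` above `B ⊔ A` forces the kernel of `δ` to be exactly `B ⊔ A`.
  have hKle : K ≤ B ⊔ A := by
    by_contra h
    have h1 : K ∈ Q := ⟨hKn, lt_of_le_not_ge hle h, hKN.trans hNM⟩
    have h2 := relIndex_lt_of_lt hle hKlt
      (fun h => hfin' (relIndex_eq_zero_of_le_right hNM h))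
    exact h2.1.not_ge (hNmin h1 h2.1.le)
  have hBI : B ≤ I := fun b hb => (hI b).2 ⟨1, one_mem N, by
    rw [hδ.map_one, (QuotientGroup.eq_one_iff b).2 hb]⟩
  have hIN : I ≤ N := by
    intro y hy
    obtain ⟨w, hw, hyw⟩ := (hI y).1 hy
    rw [hz, eq_comm, QuotientGroup.eq] at hyw
    rw [← mul_inv_cancel_left ⁅w, z⁆ y]
    exact N.mul_mem (commutator_mem_left hNn hw z) (hBN hyw)
  -- If `δ w` is represented in `A`, it is central modulo `B`, so `w` is fixed modulo the kernel `B
  -- ⊔ A` and hence lies in it.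
  have hIA : I ⊓ A ≤ A₀ := by
    intro y hy
    obtain ⟨hyI, hyA⟩ := mem_inf.1 hy
    obtain ⟨w, hw, hyw⟩ := (hI y).1 hyI
    have hwK : w ∈ K := by
      refine hle (hclBA w (hNM hw) fun g => hKle ((hK _).2 ⟨commutator_mem_left hNn hw g, ?_⟩))
      rw [hδ.map_commutator hNn hw, ← hyw, ← mk_commutator, QuotientGroup.eq_one_iff]
      exact hA₀B (hA y hyA g)
    rw [((hK w).1 hwK).2, QuotientGroup.eq_one_iff] at hyw
    exact hBA (mem_inf.2 ⟨hyw, hyA⟩)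
  have hIP : I ∈ P := ⟨hIn, hA₀B.trans hBI, hIN.trans hNM, hIA⟩
  -- Now `I` competes with `B`, so the choice of `B` keeps `I` inside `B ⊔ A`; with `hIA` this makes
  -- `δ` trivial.
  have hsup : I ⊔ A ≤ B ⊔ A := by
    by_contra h
    have h1 : B ⊔ A ≤ I ⊔ A := sup_le_sup_right hBI A
    have h2 : (I ⊔ A).relIndex M ≤ (B ⊔ A).relIndex M := relIndex_le_of_le_left h1 hfin'
    have h3 := le_antisymm h2 (hmin hIP h2)
    have h4 := relIndex_mul_relIndex _ _ _ h1 (sup_le (hIN.trans hNM) hAM)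
    rw [h3] at h4
    exact h (relIndex_eq_one.1 ((Nat.mul_eq_right hfin').1 h4))
  refine hv ?_
  have hvI : ⁅v, z⁆ ∈ I := (hI _).2 ⟨v, hvN, (hz v).symm⟩
  obtain ⟨b, hb, a, ha, hba⟩ := mem_sup_of_normal_right.1 (hsup (mem_sup_left hvI))
  have haI : a ∈ I := by
    have : a = b⁻¹ * ⁅v, z⁆ := by rw [← hba]; group
    rw [this]
    exact I.mul_mem (I.inv_mem (hBI hb)) hvI
  rw [hz, QuotientGroup.eq_one_iff, ← hba]
  exact B.mul_mem hb (hA₀B (hIA (mem_inf.2 ⟨haI, ha⟩)))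

end Fitting

/-! ### From a finite normal subgroup with hypercentral quotient to the index of the hypercenter. -/

section FiniteByHypercentral

variable {G : Type u} [Group G]

theorem HyperOver.map {G' : Type u} [Group G'] {f : G →* G'} (hf : Function.Surjective f)
    {A B : Subgroup G} (h : HyperOver A B) : HyperOver (A.map f) (B.map f) := by
  intro K hK hAK hc
  rw [map_le_iff_le_comap] at hAK ⊢
  refine h _ inferInstance hAK fun x hx hg => hc _ (mem_map_of_mem f hx) fun g => ?_
  obtain ⟨g, rfl⟩ := hf g
  rw [← map_commutatorElement]
  exact hg g

theorem HyperOver.comap {G' : Type u} [Group G'] {f : G →* G'} (hf : Function.Surjective f)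
    {A B : Subgroup G'} (h : HyperOver A B) : HyperOver (A.comap f) (B.comap f) := by
  intro K hK hAK hc
  have hker : f.ker ≤ K := (ker_le_comap f A).trans hAK
  have hA : A ≤ K.map f := by
    rw [← map_comap_eq_self_of_surjective hf A]
    exact map_mono hAK
  rw [← comap_map_eq_self hker]
  refine comap_mono (h _ (hK.map f hf) hA fun x hx hg => ?_)
  obtain ⟨x, rfl⟩ := hf x
  refine mem_map_of_mem f (hc x hx fun g => ?_)
  rw [← comap_map_eq_self hker, mem_comap, map_commutatorElement]
  exact hg (f g)

/-- Conjugation embeds `G / C_G(L)` into the automorphisms of `L`, and these are among the maps `L →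
L`. -/
theorem index_centralizer_le (L : Subgroup G) [L.Normal] [Finite L] :
    (centralizer (L : Set G)).index ≠ 0 ∧
      (centralizer (L : Set G)).index ≤ Nat.card L ^ Nat.card L := by
  have hker : (MulAut.conjNormal (H := L)).ker = centralizer (L : Set G) := by
    ext g
    rw [MonoidHom.mem_ker, MulEquiv.ext_iff, mem_centralizer_iff, Subtype.forall]
    refine forall₂_congr fun a ha => ?_
    rw [Subtype.ext_iff, MulAut.conjNormal_apply, MulAut.one_apply, mul_inv_eq_iff_eq_mul, eq_comm]
  have hfin : Finite (MulAut L) := Finite.of_injective (fun e : MulAut L => (e : L → L))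
    DFunLike.coe_injective
  rw [← hker, index_ker]
  refine ⟨Nat.card_pos.ne', ?_⟩
  rw [← Nat.card_fun]
  exact Nat.card_le_card_of_injective (fun e : (MulAut.conjNormal (H := L)).range =>
    ((e : MulAut L) : L → L)) (DFunLike.coe_injective.comp Subtype.val_injective)

/-- If a centreless group `G` has a finite normal subgroup `L` with `G / L` hypercentral, then `L`
contains its own centralizer. -/
theorem centralizer_le_of_hyperOver (hZ : ClosedIn (⊥ : Subgroup G) ⊤) (L : Subgroup G)
    [L.Normal] [Finite L] (hL : HyperOver L ⊤) : centralizer (L : Set G) ≤ L := by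
  set C := centralizer (L : Set G) with hCdef
  have hcomm : ∀ c ∈ C, ∀ l ∈ L, Commute c l := fun c hc l hl =>
    (mem_centralizer_iff.1 hc l hl).symm
  let X : Subgroup G := C ⊓ L.upperCentralSeriesStep
  have hXn : X.Normal := by
    have : L.upperCentralSeriesStep.Normal := by
      rw [Subgroup.upperCentralSeriesStep_eq_comap_center]
      infer_instance
    infer_instance
  have hX : ∀ x, x ∈ X ↔ x ∈ C ∧ ∀ g, ⁅x, g⁆ ∈ L := fun x => Iff.rfl
  -- Conjugating `x, y ∈ X` changes them only by elements of `L`, which commute with `C`. Hence `⁅x,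
  -- y⁆` is central, so trivial.
  have hXX : ⁅X, X⁆ ≤ ⊥ := by
    rw [commutator_le]
    intro x hx y hy
    refine hZ _ (mem_top _) fun g => ?_
    rw [hX] at hx hy
    have hx' : ⁅g, x⁆ ∈ L := by simpa using L.inv_mem (hx.2 g)
    have hy' : ⁅g, y⁆ ∈ L := by simpa using L.inv_mem (hy.2 g)
    have hgy : g * y * g⁻¹ ∈ C := (inferInstance : C.Normal).conj_mem y hy.1 g
    have h1 : g * ⁅x, y⁆ * g⁻¹ = ⁅x, y⁆ := by
      have e1 : ⁅⁅g, x⁆ * x, g * y * g⁻¹⁆ = ⁅x, g * y * g⁻¹⁆ := by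
        rw [commutatorElement_mul_left_eq_conj_mul, (hcomm _ hgy _ hx').symm.commutator_eq, mul_one]
        have : Commute ⁅x, g * y * g⁻¹⁆ ⁅g, x⁆ :=
          hcomm _ (commutator_mem_left inferInstance hx.1 _) _ hx'
        rw [← this.eq, mul_inv_cancel_right]
      have e2 : ⁅x, ⁅g, y⁆ * y⁆ = ⁅x, y⁆ := by
        rw [commutatorElement_mul_right_eq_mul_conj, (hcomm _ hx.1 _ hy').commutator_eq, one_mul]
        have : Commute ⁅x, y⁆ ⁅g, y⁆ := hcomm _ (commutator_mem_left inferInstance hx.1 _) _ hy'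
        rw [← this.eq, mul_inv_cancel_right]
      rw [conjugate_commutatorElement, show g * x * g⁻¹ = ⁅g, x⁆ * x by group, e1,
        show g * y * g⁻¹ = ⁅g, y⁆ * y by group, e2]
    rw [mem_bot, commutatorElement_eq_one_iff_mul_comm, ← mul_inv_eq_iff_eq_mul.1 h1]
  have hXL : ⁅X, L⁆ ≤ ⊥ := by
    rw [commutator_le]
    intro x hx l hl
    exact mem_bot.2 (hcomm x ((hX x).1 hx).1 l hl).commutator_eq
  let W : Subgroup G := C ⊓ L
  have hWX : W ≤ X := fun x hx =>
    (hX x).2 ⟨(mem_inf.1 hx).1, commutator_mem_left inferInstance (mem_inf.1 hx).2⟩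
  have hWcl : ClosedIn W X := by
    refine closedIn_of_finite hXn hXX hXL hL (hZ.mono le_top) W inferInstance bot_le hWX ?_
    rw [relIndex_bot_left]
    have : Finite W := Finite.of_injective (inclusion (inf_le_right : W ≤ L))
      (inclusion_injective _)
    exact Nat.card_pos.ne'
  -- A non-trivial `C L / L` would contain a non-trivial central element of `G / L`, represented by
  -- some `c ∈ X`; but `c` is fixed modulo `W`, so it lies in `W ≤ L`.
  have hH : HyperOver L (C ⊔ L) := hL.of_le inferInstance inferInstance le_top
  refine le_sup_left.trans (hH L inferInstance le_rfl fun x hx hg => ?_)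
  obtain ⟨c, hc, l, hl, rfl⟩ := mem_sup_of_normal_right.1 hx
  have hcX : c ∈ X := by
    refine (hX c).2 ⟨hc, fun g => ?_⟩
    have h := hg g
    rw [← QuotientGroup.eq_one_iff, mk_commutator, QuotientGroup.mk_mul,
      (QuotientGroup.eq_one_iff l).2 hl, mul_one, ← mk_commutator, QuotientGroup.eq_one_iff] at h
    exact h
  have hcW : c ∈ W := hWcl c hcX fun g =>
    mem_inf.2 ⟨commutator_mem_left inferInstance hc g, ((hX c).1 hcX).2 g⟩
  exact L.mul_mem (mem_inf.1 hcW).2 hl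

theorem card_le_of_hyperOver (hZ : ClosedIn (⊥ : Subgroup G) ⊤) (L : Subgroup G)
    [L.Normal] [Finite L] (hL : HyperOver L ⊤) :
    Nat.card G ≠ 0 ∧ Nat.card G ≤ Nat.card L ^ Nat.card L * Nat.card L := by
  have hle := centralizer_le_of_hyperOver hZ L hL
  obtain ⟨h1, h2⟩ := index_centralizer_le L
  have : Finite (centralizer (L : Set G)) := Finite.of_injective (inclusion hle)
    (inclusion_injective hle)
  have h3 : Nat.card (centralizer (L : Set G)) ≤ Nat.card L :=
    Nat.card_le_card_of_injective _ (inclusion_injective hle)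
  rw [← index_mul_card (centralizer (L : Set G))]
  exact ⟨mul_ne_zero h1 Nat.card_pos.ne', Nat.mul_le_mul h2 h3⟩

/-- If `B / A` is finite and `G / B` is hypercentral, then the index of the hypercenter of `G / A`
is bounded in terms of the order of `B / A`. -/
theorem index_hypercenter_quotient_le {A B : Subgroup G} [A.Normal] [B.Normal] {m : ℕ}
    (h0 : A.relIndex B ≠ 0) (hm : A.relIndex B ≤ m) (hB : HyperOver B ⊤) :
    (hypercenter (G ⧸ A)).index ≠ 0 ∧ (hypercenter (G ⧸ A)).index ≤ m ^ m * m := by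
  set Z : Subgroup G := (hypercenter (G ⧸ A)).comap (mk' A) with hZdef
  have hAZ : A ≤ Z := (ker_mk' A).ge.trans (ker_le_comap _ _)
  have hidx : (hypercenter (G ⧸ A)).index = Nat.card (G ⧸ Z) := by
    rw [← index_comap_of_surjective _ (mk'_surjective A), index_eq_card]
  -- Factoring out the full hypercenter leaves a trivial centre.
  have hcl : ClosedIn (⊥ : Subgroup (G ⧸ Z)) ⊤ := by
    intro x _ hx
    induction x using QuotientGroup.induction_on with
    | H x =>
      rw [mem_bot, QuotientGroup.eq_one_iff]
      refine mem_comap_hypercenter_of_commutator_mem fun g => ?_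
      have := hx g
      rwa [mem_bot, ← mk_commutator, QuotientGroup.eq_one_iff] at this
  have hL : HyperOver (B.map (mk' Z)) ⊤ := by
    have := hB.map (mk'_surjective Z)
    rwa [map_top_of_surjective _ (mk'_surjective Z)] at this
  have hcard : Nat.card (B.map (mk' Z)) = Z.relIndex B := by
    rw [← relIndex_ker, ker_mk']
  have hne : Z.relIndex B ≠ 0 := fun h => h0 (relIndex_eq_zero_of_le_left hAZ h)
  have hle : Nat.card (B.map (mk' Z)) ≤ m :=
    (hcard.le.trans (relIndex_le_of_le_left hAZ h0)).trans hm
  have : Finite (B.map (mk' Z)) := Nat.finite_of_card_ne_zero (hcard ▸ hne)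
  have : (B.map (mk' Z)).Normal := (inferInstance : B.Normal).map _ (mk'_surjective Z)
  obtain ⟨h1, h2⟩ := card_le_of_hyperOver hcl (B.map (mk' Z)) hL
  rw [hidx]
  refine ⟨h1, h2.trans (Nat.mul_le_mul ?_ hle)⟩
  exact (Nat.pow_le_pow_left hle _).trans (Nat.pow_le_pow_right (Nat.card_pos.trans_le hle) hle)

end FiniteByHypercentral

/-! ### Finite central series and the three subgroups lemma. -/

section CentralSeries

variable {G : Type u} [Group G]

/-- If each `⁅y, g⁆` lies in some finite term, one term serves for all generators `g`, hence for all
`g`. So the series does not grow past its finite terms. -/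
theorem mem_upperCentralSeries_of_mem_hypercenter [hG : Group.FG G] {x : G}
    (hx : x ∈ hypercenter G) : ∃ n, x ∈ Subgroup.upperCentralSeries G n := by
  refine mem_of_mem_hypercenter (V := Set.univ) (H := Set.univ)
    (K := {x | ∃ n, x ∈ Subgroup.upperCentralSeries G n}) (fun _ _ _ _ => trivial) ⟨0, one_mem _⟩
    (fun y _ hy => ?_) trivial hx
  choose a ha using fun g => hy g trivial
  obtain ⟨T, hT⟩ := hG.out
  let N := T.sup a
  refine ⟨N + 1, Subgroup.mem_upperCentralSeries_succ_iff.2 fun g => ?_⟩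
  let D : Subgroup G := (centralizer {(y : G ⧸ Subgroup.upperCentralSeries G N)}).comap
    (mk' (Subgroup.upperCentralSeries G N))
  have hD : ∀ g, g ∈ D ↔ ⁅y, g⁆ ∈ Subgroup.upperCentralSeries G N := by
    intro g
    simp only [D, mem_comap, mem_centralizer_singleton_iff, mk'_apply]
    rw [← QuotientGroup.eq_one_iff, mk_commutator, commutatorElement_eq_one_iff_mul_comm, eq_comm]
  have hle : (⊤ : Subgroup G) ≤ D := by
    rw [← hT, closure_le]
    exact fun t ht => (hD t).2 (Subgroup.upperCentralSeries_mono G (Finset.le_sup ht) (ha t))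
  exact (hD g).1 (hle (mem_top g))

theorem exists_le_upperCentralSeries [Group.FG G] {Z : Subgroup G} (hZ : Z.FG)
    (hle : Z ≤ hypercenter G) : ∃ n, Z ≤ Subgroup.upperCentralSeries G n := by
  obtain ⟨T, rfl⟩ := hZ
  choose! a ha using fun x (hx : x ∈ closure (T : Set G)) =>
    mem_upperCentralSeries_of_mem_hypercenter (hle hx)
  refine ⟨T.sup a, (closure_le _).2 fun t ht => ?_⟩
  exact Subgroup.upperCentralSeries_mono G (Finset.le_sup ht) (ha t (subset_closure ht))

theorem le_iff_map_mk_eq_bot {N H : Subgroup G} [N.Normal] : H ≤ N ↔ H.map (mk' N) = ⊥ := by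
  rw [Subgroup.map_eq_bot_iff, ker_mk']

/-- The three subgroups lemma modulo a normal subgroup. -/
theorem commutator_commutator_le_of_rotate {N H₁ H₂ H₃ : Subgroup G} [N.Normal]
    (h₁ : ⁅⁅H₂, H₃⁆, H₁⁆ ≤ N) (h₂ : ⁅⁅H₃, H₁⁆, H₂⁆ ≤ N) : ⁅⁅H₁, H₂⁆, H₃⁆ ≤ N := by
  rw [le_iff_map_mk_eq_bot, map_commutator, map_commutator] at *
  exact commutator_commutator_eq_bot_of_rotate h₁ h₂

theorem commutator_lowerCentralSeries_upperCentralSeries_le (i n : ℕ) :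
    ⁅(⊤ : Subgroup G).lowerCentralSeries i, Subgroup.upperCentralSeries G (n + i + 1)⁆ ≤
      Subgroup.upperCentralSeries G n := by
  induction i generalizing n with
  | zero =>
    rw [commutator_comm]
    exact Subgroup.commutator_upperCentralSeries_top_le G n
  | succ i ih =>
    rw [Subgroup.lowerCentralSeries_succ]
    refine commutator_commutator_le_of_rotate ?_ ?_
    · rw [commutator_comm ⊤, commutator_comm]
      exact (commutator_mono le_rfl (Subgroup.commutator_upperCentralSeries_top_le G _)).trans (ih n)
    · rw [commutator_comm (Subgroup.upperCentralSeries G _)]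
      refine (commutator_mono ?_ le_rfl).trans (Subgroup.commutator_upperCentralSeries_top_le G n)
      have := ih (n + 1)
      rwa [show n + 1 + i + 1 = n + (i + 1) + 1 by omega] at this

/-- Modulo `K ≥ A` every element of `G` comes from `F`, so closedness of `K` lifts the lower central
terms of `F` into `K` one at a time, from `n` down to `0`. Normality of `F` is not needed. -/
theorem hyperOver_of_lowerCentralSeries_le {A F : Subgroup G} (hFA : F ⊔ A = ⊤) {n : ℕ}
    (h : F.lowerCentralSeries n ≤ A) : HyperOver A ⊤ := by
  intro K hK hAK hc
  have hFK : F ⊔ K = ⊤ := top_le_iff.1 (hFA.ge.trans (sup_le_sup_left hAK F))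
  have key : ∀ j i, i + j = n → F.lowerCentralSeries i ≤ K := by
    intro j
    induction j with
    | zero =>
      rintro i rfl
      exact h.trans hAK
    | succ j ih =>
      intro i hi x hx
      refine hc x (mem_top x) fun g => ?_
      obtain ⟨y, hy, k, hk, rfl⟩ := mem_sup_of_normal_right.1 (hFK.ge (mem_top g))
      rw [← QuotientGroup.eq_one_iff, mk_commutator, QuotientGroup.mk_mul,
        (QuotientGroup.eq_one_iff k).2 hk, mul_one, ← mk_commutator, QuotientGroup.eq_one_iff]
      exact ih (i + 1) (by omega) (commutator_mem_commutator hx hy)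
  rw [← hFA]
  exact sup_le (key n 0 (zero_add n)) hAK

end CentralSeries

/-! ### Schur's theorem with a bound. -/

section Schur

/-- A commutator depends only on the cosets of its entries modulo the centre, so there are at most
`k * k` commutators. -/
theorem card_commutator_le_of_index_center {L : Type u} [Group L] {k : ℕ}
    (h0 : (center L).index ≠ 0) (hk : (center L).index ≤ k) :
    Finite (commutator L) ∧ Nat.card (commutator L) ≤ k ^ (k * (k * k) + 1) := by
  have hfin : Finite (L ⧸ center L) := Nat.finite_of_card_ne_zero h0
  have hmul : ∀ a b z w : L, z ∈ center L → w ∈ center L → ⁅a * z, b * w⁆ = ⁅a, b⁆ := by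
    intro a b z w hz hw
    rw [commutatorElement_mul_left_eq_conj_mul, commutatorElement_mul_right_eq_mul_conj,
      commutatorElement_mul_right_eq_mul_conj a,
      commutatorElement_eq_one_iff_mul_comm.2 (mem_center_iff.1 hz b).symm,
      commutatorElement_eq_one_iff_mul_comm.2 (mem_center_iff.1 hw z),
      commutatorElement_eq_one_iff_mul_comm.2 (mem_center_iff.1 hw a)]
    group
  let e : (L ⧸ center L) × (L ⧸ center L) → commutatorSet L :=
    fun q => ⟨⁅q.1.out, q.2.out⁆, commutator_mem_commutatorSet _ _⟩
  have he : Function.Surjective e := by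
    rintro ⟨_, a, b, rfl⟩
    refine ⟨((a : L ⧸ center L), (b : L ⧸ center L)), Subtype.ext ?_⟩
    obtain ⟨z, hz⟩ := mk_out_eq_mul (center L) a
    obtain ⟨w, hw⟩ := mk_out_eq_mul (center L) b
    change ⁅(a : L ⧸ center L).out, (b : L ⧸ center L).out⁆ = ⁅a, b⁆
    rw [hz, hw, hmul a b z w z.2 w.2]
  have : Finite (commutatorSet L) := Finite.of_surjective e he
  have hset : Nat.card (commutatorSet L) ≤ k * k := by
    refine (Nat.card_le_card_of_surjective e he).trans ?_
    rw [Nat.card_prod]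
    exact Nat.mul_le_mul hk hk
  refine ⟨inferInstance, ?_⟩
  have hdvd := card_commutator_dvd_index_center_pow L
  have hk0 : 0 < k := (Nat.pos_of_ne_zero h0).trans_le hk
  refine (Nat.le_of_dvd (pow_pos (Nat.pos_of_ne_zero h0) _) hdvd).trans ?_
  refine (Nat.pow_le_pow_left hk _).trans (Nat.pow_le_pow_right hk0 ?_)
  exact Nat.succ_le_succ (Nat.mul_le_mul hk hset)

end Schur

/-! ### Complements to a finite central chain. -/

section Complement

variable {G : Type u} [Group G]

/-- The complement `B` of `A n / A 0` in `L / A 0` obtained by splitting off the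
factors of a central chain one at a time. -/
theorem exists_complement_of_chain {L : Subgroup G} (hLn : L.Normal) (hL : HyperOver L ⊤)
    {A : ℕ → Subgroup G} (hAn : ∀ i, (A i).Normal) (hmono : Monotone A) (hAL : ∀ i, A i ≤ L)
    (hLL : ⁅L, L⁆ ≤ A 0) (hcent : ∀ i, ∀ a ∈ A (i + 1), ∀ g, ⁅a, g⁆ ∈ A i) {n : ℕ}
    (hcl : ∀ W : Subgroup G, W.Normal → A n ≤ W → W ≤ L → ClosedIn W L)
    (hfin : (A n).relIndex L ≠ 0) :
    ∃ B : Subgroup G, B.Normal ∧ B ≤ L ∧ B ⊓ A n = A 0 ∧ B ⊔ A n = L := by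
  suffices h : ∀ j i, i + j = n →
      ∃ B : Subgroup G, B.Normal ∧ B ≤ L ∧ B ⊓ A n = A i ∧ B ⊔ A n = L from h n 0 (zero_add n)
  intro j
  induction j with
  | zero =>
    rintro i rfl
    exact ⟨L, hLn, le_rfl, inf_eq_right.2 (hAL _), sup_eq_left.2 (hAL _)⟩
  | succ j ih =>
    intro i hi
    obtain ⟨M, hMn, hML, hMA, hMsup⟩ := ih (i + 1) (by omega)
    have hAM : A (i + 1) ≤ M := hMA ▸ inf_le_left
    have hMM : ⁅M, L⁆ ≤ A i := ((commutator_mono hML le_rfl).trans hLL).trans (hmono (Nat.zero_le i))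
    -- The hypothesis on `L / A n` passes to `M / A (i + 1)` because `M` meets `A n` in `A (i + 1)`
    -- only.
    have hcl' : ∀ W : Subgroup G, W.Normal → A (i + 1) ≤ W → W ≤ M → ClosedIn W M := by
      intro W hWn hAW hWM x hx hg
      have hx' : x ∈ W ⊔ A n :=
        hcl (W ⊔ A n) inferInstance le_sup_right (sup_le (hWM.trans hML) (hAL n)) x (hML hx)
          fun g => le_sup_left (a := W) (hg g)
      obtain ⟨w, hw, a, ha, rfl⟩ := mem_sup_of_normal_right.1 hx'
      have haM : a ∈ M := by simpa using M.mul_mem (M.inv_mem (hWM hw)) hx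
      exact W.mul_mem hw (hAW (hMA ▸ mem_inf.2 ⟨haM, ha⟩))
    have hfin' : (A (i + 1)).relIndex M ≠ 0 := by
      rw [← hMA, inf_comm, inf_relIndex_right]
      exact fun h => hfin (relIndex_eq_zero_of_le_right hML h)
    obtain ⟨B, hBn, -, hBM, hBA, hBsup⟩ := exists_complement (hAn i) (hAn (i + 1)) hMn
      (hmono (Nat.le_succ i)) hAM ((commutator_mono le_rfl hML).trans hMM) hMM hL (hcent i) hcl'
      hfin'
    refine ⟨B, hBn, hBM.trans hML, ?_, ?_⟩
    · rw [← hBA, ← hMA, ← inf_assoc, inf_eq_left.2 hBM]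
    · rw [← hMsup, ← hBsup, sup_assoc, sup_eq_right.2 (hmono (by omega : i + 1 ≤ n))]

end Complement

/-! ### Finitely generated groups with hypercenter of finite index. -/

section FinitelyGenerated

variable {G : Type u} [Group G]

theorem mk_mem_upperCentralSeries (N : Subgroup G) [N.Normal] {n : ℕ} {x : G}
    (hx : x ∈ Subgroup.upperCentralSeries G n) :
    (x : G ⧸ N) ∈ Subgroup.upperCentralSeries (G ⧸ N) n := by
  induction n generalizing x with
  | zero =>
    rw [Subgroup.upperCentralSeries_zero, mem_bot] at hx ⊢
    rw [hx, QuotientGroup.mk_one]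
  | succ n ih =>
    rw [Subgroup.mem_upperCentralSeries_succ_iff] at hx ⊢
    intro g
    induction g using QuotientGroup.induction_on with
    | H g =>
      rw [← mk_commutator]
      exact ih (hx g)

/-- A finitely generated group whose hypercenter contains a normal subgroup of finite index `k` is
an extension of a finite group of order bounded in terms of `k` by a nilpotent group. -/
theorem exists_finite_lowerCentralSeries_le [Group.FG G] (Z : Subgroup G) [Z.Normal]
    (hZ : Z ≤ hypercenter G) {k : ℕ} (h0 : Z.index ≠ 0) (hk : Z.index ≤ k) :
    ∃ m, Finite ((⊤ : Subgroup G).lowerCentralSeries m) ∧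
      Nat.card ((⊤ : Subgroup G).lowerCentralSeries m) ≤ k ^ (k * (k * k) + 1) * k := by
  have : Z.FiniteIndex := ⟨h0⟩
  obtain ⟨n, hn⟩ := exists_le_upperCentralSeries ((Group.fg_iff_subgroup_fg Z).1 inferInstance) hZ
  -- This lower central term commutes with the `(n + 1)`-st centre, hence with `Z`, so `Z ⊓ L` is
  -- central in `L` and Schur's theorem bounds `⁅L, L⁆`.
  set L : Subgroup G := (⊤ : Subgroup G).lowerCentralSeries n with hLdef
  have hLn : L.Normal := inferInstance
  have hLZ : ∀ l ∈ L, ∀ z ∈ Z, Commute l z := by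
    intro l hl z hz
    have h := commutator_lowerCentralSeries_upperCentralSeries_le (G := G) n 0
    rw [zero_add] at h
    exact commutatorElement_eq_one_iff_commute.1 (mem_bot.1 (h (commutator_mem_commutator hl
      (Subgroup.upperCentralSeries_mono G (Nat.le_succ n) (hn hz)))))
  have hZL0 : Z.relIndex L ≠ 0 := fun h => h0 (index_eq_zero_of_relIndex_eq_zero h)
  have hZLk : Z.relIndex L ≤ k :=
    (Nat.le_of_dvd (Nat.pos_of_ne_zero h0) (relIndex_dvd_index_of_normal Z L)).trans hk
  have hcen : Z.subgroupOf L ≤ center L := fun z hz => mem_center_iff.2 fun l =>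
    Subtype.ext (hLZ l l.2 z (mem_subgroupOf.1 hz))
  have : (Z.subgroupOf L).FiniteIndex := ⟨hZL0⟩
  obtain ⟨hfin', hcard'⟩ := card_commutator_le_of_index_center (k := k)
    (finiteIndex_of_le hcen).index_ne_zero ((index_antitone hcen).trans hZLk)
  have hLL : ⁅L, L⁆ = (commutator L).map L.subtype := by
    rw [commutator_def, map_commutator, ← MonoidHom.range_eq_map, range_subtype]
  have hfinLL : Finite (⁅L, L⁆ : Subgroup G) := by
    rw [hLL]
    exact Set.Finite.image L.subtype (Set.toFinite (commutator L : Set L))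
  have hcardLL : Nat.card (⁅L, L⁆ : Subgroup G) ≤ k ^ (k * (k * k) + 1) := by
    rw [hLL, card_map_of_injective L.subtype_injective]
    exact hcard'
  have hL : HyperOver L ⊤ := hyperOver_of_lowerCentralSeries_le (top_sup_eq L) hLdef.ge
  -- The part of the upper central series of `G / ⁅L, L⁆` inside `L`; from index `n` on it contains
  -- `L ⊓ Z`, hence has index at most `k` in `L`.
  let A : ℕ → Subgroup G := fun i =>
    L ⊓ (Subgroup.upperCentralSeries (G ⧸ ⁅L, L⁆) i).comap (mk' ⁅L, L⁆)
  have hAn : ∀ i, (A i).Normal := fun i => inferInstance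
  have hmono : Monotone A := fun i j hij =>
    inf_le_inf_left L (comap_mono (Subgroup.upperCentralSeries_mono _ hij))
  have hA0 : A 0 = ⁅L, L⁆ := by
    simp only [A, Subgroup.upperCentralSeries_zero]
    rw [MonoidHom.comap_bot, ker_mk']
    exact inf_eq_right.2 (commutator_le_left L L)
  have hAsucc : ∀ i x, x ∈ A (i + 1) ↔ x ∈ L ∧ ∀ g, ⁅x, g⁆ ∈ A i := by
    intro i x
    simp only [A, mem_inf, mem_comap, Subgroup.mem_upperCentralSeries_succ_iff, mk'_apply,
      QuotientGroup.forall_mk, mk_commutator]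
    exact ⟨fun h => ⟨h.1, fun g => ⟨commutator_mem_left hLn h.1 g, h.2 g⟩⟩,
      fun h => ⟨h.1, fun g => (h.2 g).2⟩⟩
  have hZA : L ⊓ Z ≤ A n := inf_le_inf_left L fun z hz => mk_mem_upperCentralSeries _ (hn hz)
  have hAfin : ∀ i, n ≤ i → (A i).relIndex L ≠ 0 ∧ (A i).relIndex L ≤ k := by
    intro i hi
    have hle : L ⊓ Z ≤ A i := hZA.trans (hmono hi)
    have he : (L ⊓ Z).relIndex L = Z.relIndex L := inf_relIndex_left L Z
    exact ⟨fun h => hZL0 (he ▸ relIndex_eq_zero_of_le_left hle h),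
      (relIndex_le_of_le_left hle (he ▸ hZL0)).trans (he.le.trans hZLk)⟩
  -- At the least index the chain `A` is stationary, so `L / A r` has no non-trivial fixed points
  -- and `A r` can be split off.
  obtain ⟨r, hr, hrmin⟩ := exists_minimalFor_of_wellFoundedLT (n ≤ ·)
    (fun i => (A i).relIndex L) ⟨n, le_rfl⟩
  have hstab : A (r + 1) ≤ A r := by
    have h1 := relIndex_mul_relIndex (A r) (A (r + 1)) L (hmono (Nat.le_succ r)) inf_le_left
    have h2 := relIndex_le_of_le_left (hmono (Nat.le_succ r)) (hAfin r hr).1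
    rw [le_antisymm h2 (hrmin (hr.trans (Nat.le_succ r)) h2)] at h1
    exact relIndex_eq_one.1 ((Nat.mul_eq_right (hAfin r hr).1).1 h1)
  have hclA : ClosedIn (A r) L := fun x hx hg => hstab ((hAsucc r x).2 ⟨hx, hg⟩)
  have hLA : ⁅L, L⁆ ≤ A r := hA0 ▸ hmono (Nat.zero_le r)
  obtain ⟨B, hBn, hBL, hBA, hBsup⟩ := exists_complement_of_chain hLn hL hAn hmono
    (fun i => inf_le_left) hA0.ge (fun i a ha => ((hAsucc i a).1 ha).2) (n := r)
    (fun W hWn hAW hWL => closedIn_of_finite hLn hLA hLA hL hclA W hWn hAW hWL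
      fun h => (hAfin r hr).1 (relIndex_eq_zero_of_le_right hWL h)) (hAfin r hr).1
  have hA0B : ⁅L, L⁆ ≤ B := by
    rw [← hA0, ← hBA]
    exact inf_le_left
  have hrel : (⁅L, L⁆ : Subgroup G).relIndex B = (A r).relIndex B := by
    rw [← hA0, ← hBA, inf_comm, inf_relIndex_right]
  have hcardB : Nat.card B = Nat.card (⁅L, L⁆ : Subgroup G) * (A r).relIndex B := by
    rw [← hrel, ← relIndex_bot_left, ← relIndex_bot_left, relIndex_mul_relIndex _ _ _ bot_le hA0B]
  have hB0 : (A r).relIndex B ≠ 0 :=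
    fun h => (hAfin r hr).1 (relIndex_eq_zero_of_le_right hBL h)
  have hBfin : Finite B := Nat.finite_of_card_ne_zero (by
    rw [hcardB]
    exact mul_ne_zero Nat.card_pos.ne' hB0)
  have hBk : Nat.card B ≤ k ^ (k * (k * k) + 1) * k := by
    rw [hcardB]
    exact Nat.mul_le_mul hcardLL
      ((relIndex_le_of_le_right hBL (hAfin r hr).1).trans (hAfin r hr).2)
  -- `L = B ⊔ A r`, and each further commutation with `G` lowers the index of `A` by one, until only
  -- `B` remains.
  have hlow : ∀ j i, i + j = r → (⊤ : Subgroup G).lowerCentralSeries (n + j) ≤ B ⊔ A i := by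
    intro j
    induction j with
    | zero =>
      rintro i rfl
      exact hBsup.ge
    | succ j ih =>
      intro i hi
      rw [← add_assoc, Subgroup.lowerCentralSeries_succ, commutator_le]
      intro x hx g _
      obtain ⟨b, hb, a, ha, rfl⟩ := mem_sup_of_normal_right.1 (ih (i + 1) (by omega) hx)
      rw [commutatorElement_mul_left_eq_conj_mul]
      exact mul_mem (mem_sup_right ((hAn i).conj_mem _ (((hAsucc i a).1 ha).2 g) b))
        (mem_sup_left (commutator_mem_left hBn hb g))
  have hle : (⊤ : Subgroup G).lowerCentralSeries (n + r) ≤ B := by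
    have := hlow r 0 (zero_add r)
    rwa [hA0, sup_eq_left.2 hA0B] at this
  exact ⟨n + r, Finite.of_injective _ (inclusion_injective hle),
    (Nat.card_le_card_of_injective _ (inclusion_injective hle)).trans hBk⟩

end FinitelyGenerated

/-! ### From the index of the hypercenter to a finite normal subgroup. -/

section HypercentralResidual

variable {G : Type u} [Group G]

/-- A bound for the order of the hypercentral residual in terms of the index of the hypercenter. -/
def residualBound (k : ℕ) : ℕ := k ^ (k * (k * k) + 1) * k

/-- A bound for the index of the hypercenter in terms of the order of a finite normal subgroup with
hypercentral quotient. -/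
def hypercenterBound (m : ℕ) : ℕ := m ^ m * m

theorem subgroupOf_hypercenter_le (F : Subgroup G) :
    (hypercenter G).subgroupOf F ≤ hypercenter F := by
  intro x hx
  have h := mem_of_mem_hypercenter (V := (F : Set G)) (H := (F : Set G))
    (K := Set.image F.subtype (hypercenter F : Set F)) ?_ ⟨1, one_mem _, rfl⟩ ?_ x.2
    (mem_subgroupOf.1 hx)
  · obtain ⟨y, hy, hyx⟩ := h
    rwa [← Subtype.ext hyx]
  · exact fun a ha g hg => F.mul_mem (F.mul_mem (F.mul_mem ha hg) (F.inv_mem ha)) (F.inv_mem hg)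
  · intro a ha hg
    refine ⟨⟨a, ha⟩, mem_hypercenter_of_commutator_mem fun g => ?_, rfl⟩
    obtain ⟨y, hy, hya⟩ := hg g g.2
    have : y = ⁅(⟨a, ha⟩ : F), g⁆ := Subtype.ext hya
    rwa [← this]

/-- The intersection of the lower central series of `F`. -/
def nilpotentResidual (F : Subgroup G) : Subgroup G := ⨅ m, F.lowerCentralSeries m

theorem nilpotentResidual_mono : Monotone (nilpotentResidual (G := G)) :=
  fun _ _ h => iInf_mono fun m => Subgroup.lowerCentralSeries_mono m h

theorem nilpotentResidual_eq_of_finite {F : Subgroup G} {m₀ : ℕ}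
    (hfin : Finite (F.lowerCentralSeries m₀)) :
    ∃ m, m₀ ≤ m ∧ nilpotentResidual F = F.lowerCentralSeries m := by
  obtain ⟨m, hm, hmin⟩ := exists_minimalFor_of_wellFoundedLT (m₀ ≤ ·)
    (fun m => Nat.card (F.lowerCentralSeries m)) ⟨m₀, le_rfl⟩
  refine ⟨m, hm, le_antisymm (iInf_le _ m) (le_iInf fun j => ?_)⟩
  rcases le_total j m with hj | hj
  · exact F.lowerCentralSeries_antitone hj
  · have : Finite (F.lowerCentralSeries m) := Finite.of_injective _
      (inclusion_injective (F.lowerCentralSeries_antitone hm))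
    have hle := F.lowerCentralSeries_antitone hj
    exact (eq_of_le_of_card_ge hle (hmin (hm.trans hj)
      (Nat.card_le_card_of_injective _ (inclusion_injective hle)))).ge

theorem exists_nilpotentResidual_eq {k : ℕ} (h0 : (hypercenter G).index ≠ 0)
    (hk : (hypercenter G).index ≤ k) {F : Subgroup G} (hF : F.FG) :
    ∃ m, nilpotentResidual F = F.lowerCentralSeries m ∧ Finite (nilpotentResidual F) ∧
      Nat.card (nilpotentResidual F) ≤ residualBound k := by
  have : Group.FG F := (Group.fg_iff_subgroup_fg F).2 hF
  have h0' : (hypercenter G).relIndex F ≠ 0 := fun h => h0 (index_eq_zero_of_relIndex_eq_zero h)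
  have hk' : (hypercenter G).relIndex F ≤ k :=
    (Nat.le_of_dvd (Nat.pos_of_ne_zero h0) (relIndex_dvd_index_of_normal _ F)).trans hk
  obtain ⟨m₀, hfin, hcard⟩ := exists_finite_lowerCentralSeries_le
    ((hypercenter G).subgroupOf F) (subgroupOf_hypercenter_le F) h0' hk'
  have hfin' : Finite (F.lowerCentralSeries m₀) := by
    rw [← Subgroup.top_subtype_lowerCentralSeries]
    exact Set.Finite.image F.subtype (Set.toFinite ((⊤ : Subgroup F).lowerCentralSeries m₀ : Set F))
  obtain ⟨m, hm, he⟩ := nilpotentResidual_eq_of_finite hfin'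
  have hle : nilpotentResidual F ≤ F.lowerCentralSeries m₀ := iInf_le _ m₀
  refine ⟨m, he, Finite.of_injective _ (inclusion_injective hle),
    (Nat.card_le_card_of_injective _ (inclusion_injective hle)).trans ?_⟩
  rw [← Subgroup.top_subtype_lowerCentralSeries, card_map_of_injective F.subtype_injective]
  exact hcard

/-- If the hypercenter of `G` has finite index, then `G` is an extension of a finite group of
bounded order by a hypercentral group. -/
theorem exists_finite_hyperOver_top {k : ℕ} (h0 : (hypercenter G).index ≠ 0)
    (hk : (hypercenter G).index ≤ k) :
    ∃ L : Subgroup G, L.Normal ∧ Finite L ∧ Nat.card L ≤ residualBound k ∧ HyperOver L ⊤ := by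
  -- All these residuals have order at most `residualBound k`, so minimizing the difference
  -- maximizes the order.
  obtain ⟨F, hF, hmax⟩ := exists_minimalFor_of_wellFoundedLT (fun F : Subgroup G => F.FG)
    (fun F => residualBound k - Nat.card (nilpotentResidual F)) ⟨⊥, FG.bot⟩
  obtain ⟨-, -, hfin, hcard⟩ := exists_nilpotentResidual_eq h0 hk hF
  have hstab : ∀ F' : Subgroup G, F'.FG → F ≤ F' → nilpotentResidual F' = nilpotentResidual F := by
    intro F' hF' hle
    obtain ⟨-, -, hfin', hcard'⟩ := exists_nilpotentResidual_eq h0 hk hF'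
    have hle' := nilpotentResidual_mono hle
    have h1 := Nat.card_le_card_of_injective _ (inclusion_injective hle')
    refine (eq_of_le_of_card_ge hle' ?_).symm
    have h2 := hmax hF' (Nat.sub_le_sub_left h1 _)
    dsimp only at h2
    omega
  have hstab' : ∀ F' : Subgroup G, F'.FG → F ≤ F' →
      ∃ m, nilpotentResidual F = F'.lowerCentralSeries m := by
    intro F' hF' hle
    obtain ⟨m, hm, -, -⟩ := exists_nilpotentResidual_eq h0 hk hF'
    exact ⟨m, by rw [← hm, hstab F' hF' hle]⟩
  -- Adjoining any `g` to `F` leaves the residual unchanged, and `g` normalizes the lower central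
  -- terms of a subgroup containing it.
  have hnormal : (nilpotentResidual F).Normal := by
    rw [← normalizer_eq_top_iff, eq_top_iff]
    intro g _
    obtain ⟨m, hm⟩ := hstab' (F ⊔ closure {g}) (hF.sup ⟨{g}, by simp⟩) le_sup_left
    rw [hm]
    exact Subgroup.self_le_normalizer_lowerCentralSeries _ m
      (mem_sup_right (subset_closure rfl))
  refine ⟨nilpotentResidual F, hnormal, hfin, hcard, ?_⟩
  have hfinQ : Finite (G ⧸ hypercenter G) := Nat.finite_of_card_ne_zero h0
  -- Adjoining a finite transversal of the hypercenter gives a finitely generated subgroup that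
  -- covers `G` modulo the hypercenter.
  let T : Set G := Set.range (Quotient.out : G ⧸ hypercenter G → G)
  have hT : (closure T).FG := (fg_iff _).2 ⟨T, rfl, Set.finite_range _⟩
  obtain ⟨m, hm⟩ := hstab' (F ⊔ closure T) (hF.sup hT) le_sup_left
  have htop : (F ⊔ closure T) ⊔ (hypercenter G ⊔ nilpotentResidual F) = ⊤ := by
    rw [eq_top_iff]
    intro g _
    obtain ⟨z, hz⟩ := mk_out_eq_mul (hypercenter G) g
    rw [← mul_inv_eq_iff_eq_mul] at hz
    rw [← hz]
    exact mul_mem (mem_sup_left (mem_sup_right (subset_closure ⟨_, rfl⟩)))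
      (mem_sup_right (mem_sup_left (inv_mem z.2)))
  have h1 : HyperOver (hypercenter G ⊔ nilpotentResidual F) ⊤ :=
    hyperOver_of_lowerCentralSeries_le htop (hm.ge.trans le_sup_right)
  have h2 : HyperOver (nilpotentResidual F) (hypercenter G ⊔ nilpotentResidual F) :=
    fun K hK hle hc => sup_le (hyperOver_bot_hypercenter K hK bot_le (hc.mono le_sup_left)) hle
  exact h2.trans h1 le_top

end HypercentralResidual

/-! ### Descent along the given series. -/

section Main

variable {G : Type u} [Group G]

theorem index_hypercenter_quotient_le_of_hyperOver {A F B : Subgroup G} [A.Normal] [F.Normal]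
    [B.Normal] (hFA : HyperOver F A) {b : ℕ} (h0 : A.relIndex B ≠ 0) (hb : A.relIndex B ≤ b)
    (hB : HyperOver B ⊤) :
    (hypercenter (G ⧸ F)).index ≠ 0 ∧ (hypercenter (G ⧸ F)).index ≤ hypercenterBound b := by
  obtain ⟨h1, h2⟩ := index_hypercenter_quotient_le h0 hb hB
  have hAZ : A ≤ (hypercenter (G ⧸ A)).comap (mk' A) := (ker_mk' A).ge.trans (ker_le_comap _ _)
  have hle : (hypercenter (G ⧸ A)).comap (mk' A) ≤ (hypercenter (G ⧸ F)).comap (mk' F) :=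
    (hyperOver_iff inferInstance).1 (hFA.trans ((hyperOver_iff inferInstance).2 le_rfl) hAZ)
  have hdvd := index_dvd_of_le hle
  rw [index_comap_of_surjective _ (mk'_surjective A),
    index_comap_of_surjective _ (mk'_surjective F)] at hdvd
  exact ⟨ne_zero_of_dvd_ne_zero h1 hdvd, (Nat.le_of_dvd (Nat.pos_of_ne_zero h1) hdvd).trans h2⟩

theorem index_hypercenter_le {B : Subgroup G} [B.Normal] {m : ℕ}
    (h0 : (⊥ : Subgroup G).relIndex B ≠ 0) (hm : (⊥ : Subgroup G).relIndex B ≤ m)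
    (hB : HyperOver B ⊤) :
    (hypercenter G).index ≠ 0 ∧ (hypercenter G).index ≤ hypercenterBound m := by
  obtain ⟨h1, h2⟩ := index_hypercenter_quotient_le h0 hm hB
  have hle : (hypercenter (G ⧸ (⊥ : Subgroup G))).comap (mk' ⊥) ≤ hypercenter G :=
    (le_hypercenter_iff inferInstance).2 ((hyperOver_iff inferInstance).2 le_rfl)
  have hdvd := index_dvd_of_le hle
  rw [index_comap_of_surjective _ (mk'_surjective _)] at hdvd
  exact ⟨ne_zero_of_dvd_ne_zero h1 hdvd, (Nat.le_of_dvd (Nat.pos_of_ne_zero h1) hdvd).trans h2⟩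

/-- One step of the descent, with `A`, `F`, `D` in the roles of `G_{i-1}`, `F_i`, `G_i`: the finite
subgroup is found in `G / F` and pulled back. -/
theorem exists_hyperOver_top_of_factors {A F D B : Subgroup G} [A.Normal] [F.Normal] [B.Normal]
    (hDF : D ≤ F) (hD : D.relIndex F ≠ 0) (hFA : HyperOver F A) {b : ℕ}
    (h0 : A.relIndex B ≠ 0) (hb : A.relIndex B ≤ b) (hB : HyperOver B ⊤) :
    ∃ L : Subgroup G, L.Normal ∧ D.relIndex L ≠ 0 ∧
      D.relIndex L ≤ D.relIndex F * residualBound (hypercenterBound b) ∧ HyperOver L ⊤ := by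
  obtain ⟨h1, h2⟩ := index_hypercenter_quotient_le_of_hyperOver hFA h0 hb hB
  obtain ⟨L, hLn, hfin, hcard, hL⟩ := exists_finite_hyperOver_top h1 h2
  have hrel : F.relIndex (L.comap (mk' F)) = Nat.card L := by
    have h := relIndex_ker (K := L.comap (mk' F)) (mk' F)
    rwa [ker_mk', map_comap_eq_self_of_surjective (mk'_surjective F)] at h
  have hFL : F ≤ L.comap (mk' F) := (ker_mk' F).ge.trans (ker_le_comap _ _)
  have hmul := relIndex_mul_relIndex D F (L.comap (mk' F)) hDF hFL
  rw [hrel] at hmul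
  refine ⟨L.comap (mk' F), inferInstance, ?_, ?_, ?_⟩
  · rw [← hmul]
    exact mul_ne_zero hD Nat.card_pos.ne'
  · rw [← hmul]
    exact Nat.mul_le_mul_left _ hcard
  · have := hL.comap (mk'_surjective F)
    rwa [comap_top] at this

/-- The bound for the order of a finite normal subgroup with hypercentral quotient, after `j`
finite factors of order at most `t`. -/
def seriesBound (t : ℕ) : ℕ → ℕ
  | 0 => 1
  | j + 1 => t * residualBound (hypercenterBound (seriesBound t j))

/-- A bound independent of the length of the series. -/
def totalBound (t : ℕ) : ℕ := ∑ j ∈ Finset.range (t + 1), seriesBound t j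

theorem exists_hyperOver_top_of_series {n : ℕ} {Gs : Fin (n + 1) → Subgroup G}
    {F : Fin n → Subgroup G} {t : ℕ} [∀ i, (Gs i).Normal] [∀ i, (F i).Normal] (htop : Gs 0 = ⊤)
    (hle : ∀ i : Fin n, Gs i.succ ≤ F i)
    (ht : ∀ i : Fin n, (Gs i.succ).relIndex (F i) ≠ 0 ∧ (Gs i.succ).relIndex (F i) ≤ t)
    (hyp : ∀ i : Fin n, HyperOver (F i) (Gs i.castSucc)) (i : Fin (n + 1)) :
    ∃ L : Subgroup G, L.Normal ∧ (Gs i).relIndex L ≠ 0 ∧ (Gs i).relIndex L ≤ seriesBound t i ∧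
      HyperOver L ⊤ := by
  induction i using Fin.induction with
  | zero =>
    refine ⟨⊤, inferInstance, ?_, ?_, fun K _ h _ => h⟩
    · rw [htop, relIndex_self]
      exact one_ne_zero
    · rw [htop, relIndex_self]
      exact le_rfl
  | succ i ih =>
    obtain ⟨B, hBn, h0, hb, hB⟩ := ih
    obtain ⟨L, hLn, hL0, hLb, hL⟩ :=
      exists_hyperOver_top_of_factors (hle i) (ht i).1 (hyp i) h0 hb hB
    exact ⟨L, hLn, hL0, hLb.trans (Nat.mul_le_mul_right _ (ht i).2), hL⟩

end Main

end HypercentralSeries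

/-- `Gs i` is `G_i` for `0 ≤ i ≤ n`, and `F i`, `t i` with `i : Fin n` are `F_{i+1}`, `t_{i+1}`. -/
theorem mainTheorem3 :
    ∃ f g : ℕ → ℕ, ∀ (G : Type u) [Group G] (n : ℕ)
      (Gs : Fin (n + 1) → Subgroup G) (F : Fin n → Subgroup G) (t : Fin n → ℕ)
      [∀ i, (Gs i).Normal] [∀ i, (F i).Normal],
      Gs 0 = ⊤ → Gs (Fin.last n) = ⊥ →
      (∀ i : Fin n, F i ≤ Gs i.castSucc) →
      (∀ i : Fin n, Gs i.succ ≤ F i) →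
      (∀ i : Fin n, (Gs i.succ).relIndex (F i) = t i ∧ 1 < t i) →
      (∀ i : Fin n, (Gs i.castSucc).map (QuotientGroup.mk' (F i)) ≤ hypercenter (G ⧸ F i)) →
      (∃ (L : Subgroup G) (_ : L.Normal),
        Finite L ∧ Nat.card L ≤ f (∏ i, t i) ∧ IsHypercentral (G ⧸ L)) ∧
      (hypercenter G).FiniteIndex ∧ (hypercenter G).index ≤ g (∏ i, t i) := by
  refine ⟨HypercentralSeries.totalBound,
    fun t => HypercentralSeries.hypercenterBound (HypercentralSeries.totalBound t), ?_⟩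
  intro G _ n Gs F t _ _ htop hbot _ hle ht hyp
  have hpos : 0 < ∏ i, t i := Finset.prod_pos fun i _ => zero_lt_one.trans (ht i).2
  have hle_prod : ∀ i, t i ≤ ∏ i, t i := fun i =>
    Nat.le_of_dvd hpos (Finset.dvd_prod_of_mem t (Finset.mem_univ i))
  -- All factors are at least 2, so `n ≤ 2 ^ n ≤ t`, and `seriesBound t n` is one of the summands of
  -- `totalBound t`.
  have hn : n ≤ ∏ i, t i := by
    have h : ∏ _i : Fin n, 2 ≤ ∏ i, t i := Finset.prod_le_prod' fun i _ => (ht i).2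
    rw [Finset.prod_const, Finset.card_univ, Fintype.card_fin] at h
    exact Nat.lt_two_pow_self.le.trans h
  obtain ⟨L, hLn, hL0, hLb, hL⟩ := HypercentralSeries.exists_hyperOver_top_of_series
    (t := ∏ i, t i) htop hle
    (fun i => ⟨by rw [(ht i).1]; exact (zero_lt_one.trans (ht i).2).ne', by
      rw [(ht i).1]; exact hle_prod i⟩)
    (fun i => (HypercentralSeries.hyperOver_iff inferInstance).2
      (Subgroup.map_le_iff_le_comap.1 (hyp i))) (Fin.last n)
  have hbound : HypercentralSeries.seriesBound (∏ i, t i) n ≤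
      HypercentralSeries.totalBound (∏ i, t i) :=
    Finset.single_le_sum (f := HypercentralSeries.seriesBound (∏ i, t i))
      (fun _ _ => Nat.zero_le _) (Finset.mem_range.2 (Nat.lt_succ_of_le hn))
  rw [hbot] at hL0 hLb
  have hLb' := hLb.trans hbound
  have hindex := HypercentralSeries.index_hypercenter_le hL0 hLb' hL
  rw [Subgroup.relIndex_bot_left] at hL0 hLb'
  exact ⟨⟨L, hLn, Nat.finite_of_card_ne_zero hL0, hLb',
    HypercentralSeries.isHypercentral_quotient_iff.2 hL⟩, ⟨hindex.1⟩, hindex.2⟩
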